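/- Let $K\subset[0,1]$ be the triadic (middle-thirds) Cantor set, let $\gamma=\log_3 2$ be its Hausdorff dimension, and let $\mu$ be the standard Cantor probability measure on $K$, i.e. the distribution of $\sum_{n\ge 1}\varepsilon_n 3^{-n}$, where the $\varepsilon_n$ are independent and take the values $0$ and $2$ with probability $1/2$ each. Let $\psi:(0,\infty)\to(0,\infty)$ be non-increasing, and suppose that $$\sum_{n\ge 1} n\,\bigl(3^n\psi(3^n)\bigr)^{\gamma}=\infty .$$ Then $$\mu\Bigl(\Bigl\{x\in K:\ \Bigl|x-\frac pq\Bigr|<\psi(q)\ \text{ for infinitely many rational numbers } \frac pq\in K\Bigr\}\Bigr)=1,$$ where each rational number $p/q$ is written in lowest terms with $q\ge 1$. That is, $\mu$-almost every point of $K$ is intrinsically $\psi$-well approximable. -/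

import Mathlib

open MeasureTheory

/-- The point `∑ₙ εₙ / 3 ^ (n + 1)` (`n ≥ 0`) of the triadic Cantor set whose ternary digits `εₙ` are
`2` where `ω` is `true` and `0` where `ω` is `false`. -/
noncomputable def cantorPoint (ω : ℕ → Bool) : ℝ :=
  Real.ofDigits (b := 3) fun n => bif ω n then 2 else 0

/-- The standard Cantor measure: the law of a random point of the triadic Cantor set whose
ternary digits are independent and take the values `0` and `2` with probability `1 / 2` each. -/
noncomputable def cantorMeasure : Measure ℝ :=
  (Measure.infinitePi fun _ : ℕ => (PMF.uniformOfFintype Bool).toMeasure).map cantorPoint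

/-- The map pushed forward in `cantorMeasure` is measurable, so the pushforward is genuine. -/
theorem measurable_cantorPoint : Measurable cantorPoint := by
  have h : Continuous cantorPoint := by
    refine Real.continuous_ofDigits.comp (continuous_pi fun n => ?_)
    exact (continuous_of_discreteTopology (f := fun c : Bool => (bif c then 2 else 0 : Fin 3))).comp
      (continuous_apply n)
  exact h.measurable

instance isProbabilityMeasure_cantorMeasure : IsProbabilityMeasure cantorMeasure :=
  Measure.isProbabilityMeasure_map measurable_cantorPoint.aemeasurable

/-- The points `x` of `C` that are intrinsically `ψ`-well approximable: there are infinitely many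
rational numbers `r = p / q` in `C`, where `q` is the denominator of `r` in lowest terms, such
that `|x - p / q| < ψ q`. -/
def intrinsicallyApproximable (C : Set ℝ) (ψ : ℝ → ℝ) : Set ℝ :=
  {x | x ∈ C ∧ {r : ℚ | (r : ℝ) ∈ C ∧ |x - (r : ℝ)| < ψ (r.den : ℝ)}.Infinite}

/-!
Suppose that in a random word `ω` the block of length `l` at position `n` repeats the one at an
earlier position `m`. Continuing the first `n` letters periodically from position `m` on gives a
word that agrees with `ω` on the first `n + l` letters. The corresponding point of the Cantor set
is rational, since multiplying it by `3 ^ n - 3 ^ m` changes it into an integer; so its denominator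
is at most `3 ^ n`, and it lies within `3 ^ -(n + l)` of the point `x` coded by `ω`. If `l = l n` is
the least positive length with `3 ^ -(n + l) < ψ (3 ^ n)`, it is therefore an intrinsic
`ψ`-approximation of `x`.

About `n / 2` positions `m < n / 2` are available for each `n`, and each repetition has probability
`2 ^ -(l n)`, which is comparable to `min 1 ((3 ^ n ψ (3 ^ n)) ^ γ)`. Hence the expected number of
repetitions is infinite, and it remains so when the long blocks, with `l n > n / 4`, are left out.
Two of the remaining repetitions are independent unless their shifts `n - m` are equal and their
later blocks overlap, in which case the correlation decays geometrically in the distance of the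
blocks; Chebyshev's inequality then shows that almost surely infinitely many repetitions occur. As
`x` is almost surely irrational, it is not equal to any of its approximations, so these take
infinitely many values.
-/

open Filter Topology ProbabilityTheory

section SecondMoment

variable {Ω ι : Type*} [MeasurableSpace Ω] {μ : Measure Ω}

theorem covariance_indicator_one [IsProbabilityMeasure μ] {A B : Set Ω} (hA : MeasurableSet A)
    (hB : MeasurableSet B) :
    cov[A.indicator 1, B.indicator 1; μ] = μ.real (A ∩ B) - μ.real A * μ.real B := by
  have hind {S : Set Ω} (hS : MeasurableSet S) : MemLp (S.indicator (1 : Ω → ℝ)) 2 μ :=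
    memLp_indicator_const 2 hS 1 (by simp)
  rw [covariance_eq_sub (hind hA) (hind hB), ← Set.inter_indicator_one,
    integral_indicator_one hA, integral_indicator_one hB, integral_indicator_one (hA.inter hB)]

/-- Chebyshev's inequality for the number `∑ i ∈ Q, 1_{A i}` of events that occur. -/
theorem measureReal_iInter_compl_mul_sq_le [IsProbabilityMeasure μ] {A : ι → Set Ω}
    (hA : ∀ i, MeasurableSet (A i)) (Q : Finset ι) :
    μ.real (⋂ i ∈ Q, (A i)ᶜ) * (∑ i ∈ Q, μ.real (A i)) ^ 2 ≤
      ∑ i ∈ Q, ∑ j ∈ Q, (μ.real (A i ∩ A j) - μ.real (A i) * μ.real (A j)) := by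
  set Z : Ω → ℝ := ∑ i ∈ Q, (A i).indicator 1
  set e : ℝ := ∑ i ∈ Q, μ.real (A i)
  have hind (i : ι) : MemLp ((A i).indicator (1 : Ω → ℝ)) 2 μ :=
    memLp_indicator_const 2 (hA i) 1 (by simp)
  have hZ : MemLp Z 2 μ := memLp_finsetSum' _ fun i _ => hind i
  have hmean : μ[Z] = e := by
    simp only [Z, Finset.sum_apply]
    rw [integral_finsetSum _ fun i _ => (hind i).integrable one_le_two]
    exact Finset.sum_congr rfl fun i _ => integral_indicator_one (hA i)
  have hvar : Var[Z; μ] =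
      ∑ i ∈ Q, ∑ j ∈ Q, (μ.real (A i ∩ A j) - μ.real (A i) * μ.real (A j)) := by
    rw [variance_sum' fun i _ => hind i]
    simp only [covariance_indicator_one (hA _) (hA _)]
  have he : 0 ≤ e := Finset.sum_nonneg fun i _ => measureReal_nonneg
  rw [← hvar]
  rcases he.eq_or_lt with he0 | he0
  · simp [← he0, variance_nonneg]
  have hsub : ⋂ i ∈ Q, (A i)ᶜ ⊆ {ω | e ≤ |Z ω - μ[Z]|} := by
    intro ω hω
    have hZω : Z ω = 0 := by
      simp only [Z, Finset.sum_apply]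
      exact Finset.sum_eq_zero fun i hi =>
        Set.indicator_of_notMem (Set.mem_iInter₂.1 hω i hi) _
    simp [hmean, hZω, abs_of_pos he0]
  have hcheb : μ.real (⋂ i ∈ Q, (A i)ᶜ) ≤ Var[Z; μ] / e ^ 2 :=
    ENNReal.toReal_le_of_le_ofReal (div_nonneg (variance_nonneg _ _) (sq_nonneg e))
      ((measure_mono hsub).trans (meas_ge_le_variance_div_sq hZ he0))
  exact (le_div_iff₀ (by positivity)).1 hcheb

variable {A : ι → Set Ω} {w : ι → ι → ℝ} {C : ℝ}

theorem sum_measureReal_inter_sub_mul_le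
    (hw : ∀ i j, μ.real (A i ∩ A j) ≤ μ.real (A i) * μ.real (A j) +
      (w i j * μ.real (A j) + w j i * μ.real (A i)))
    (hC : ∀ (Q : Finset ι) (j : ι), ∑ i ∈ Q, w i j ≤ C) (Q : Finset ι) :
    ∑ i ∈ Q, ∑ j ∈ Q, (μ.real (A i ∩ A j) - μ.real (A i) * μ.real (A j)) ≤
      2 * C * ∑ i ∈ Q, μ.real (A i) := by
  have hcol : ∑ j ∈ Q, ∑ i ∈ Q, w i j * μ.real (A j) ≤ C * ∑ j ∈ Q, μ.real (A j) := by
    rw [Finset.mul_sum]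
    refine Finset.sum_le_sum fun j _ => ?_
    rw [← Finset.sum_mul]
    exact mul_le_mul_of_nonneg_right (hC Q j) measureReal_nonneg
  calc ∑ i ∈ Q, ∑ j ∈ Q, (μ.real (A i ∩ A j) - μ.real (A i) * μ.real (A j))
      ≤ ∑ i ∈ Q, ∑ j ∈ Q, (w i j * μ.real (A j) + w j i * μ.real (A i)) :=
        Finset.sum_le_sum fun i _ => Finset.sum_le_sum fun j _ => by linarith [hw i j]
    _ = ∑ j ∈ Q, ∑ i ∈ Q, w i j * μ.real (A j) + ∑ i ∈ Q, ∑ j ∈ Q, w j i * μ.real (A i) := by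
        simp only [Finset.sum_add_distrib]
        rw [Finset.sum_comm]
    _ ≤ 2 * C * ∑ i ∈ Q, μ.real (A i) := by linarith

theorem ae_exists_mem_of_not_summable [IsProbabilityMeasure μ] (hA : ∀ i, MeasurableSet (A i))
    (hdiv : ¬ Summable fun i => μ.real (A i))
    (hw : ∀ i j, μ.real (A i ∩ A j) ≤ μ.real (A i) * μ.real (A j) +
      (w i j * μ.real (A j) + w j i * μ.real (A i)))
    (hC : ∀ (Q : Finset ι) (j : ι), ∑ i ∈ Q, w i j ≤ C) :
    ∀ᵐ ω ∂μ, ∃ i, ω ∈ A i := by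
  set B : Set Ω := {ω | ¬ ∃ i, ω ∈ A i}
  change μ B = 0
  by_contra hB
  have hB0 : 0 < μ.real B := ENNReal.toReal_pos hB (measure_ne_top μ B)
  refine hdiv (summable_of_sum_le (c := |2 * C| / μ.real B) (fun i => measureReal_nonneg)
    fun Q => ?_)
  set e : ℝ := ∑ i ∈ Q, μ.real (A i)
  have hsub : B ⊆ ⋂ i ∈ Q, (A i)ᶜ := fun ω hω => Set.mem_iInter₂.2 fun i _ hi => hω ⟨i, hi⟩
  have hsq : μ.real B * e ^ 2 ≤ 2 * C * e :=
    calc μ.real B * e ^ 2 ≤ μ.real (⋂ i ∈ Q, (A i)ᶜ) * e ^ 2 :=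
          mul_le_mul_of_nonneg_right (measureReal_mono hsub) (sq_nonneg e)
      _ ≤ _ := measureReal_iInter_compl_mul_sq_le hA Q
      _ ≤ 2 * C * e := sum_measureReal_inter_sub_mul_le hw hC Q
  have he : 0 ≤ e := Finset.sum_nonneg fun i _ => measureReal_nonneg
  rcases he.eq_or_lt with he | he
  · rw [← he]
    positivity
  · rw [le_div_iff₀ hB0]
    exact (le_of_mul_le_mul_right (by linarith) he).trans (le_abs_self _)

theorem ae_frequently_mem_of_not_summable [Countable ι] [IsProbabilityMeasure μ]
    (hA : ∀ i, MeasurableSet (A i))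
    (hdiv : ¬ Summable fun i => μ.real (A i))
    (hw : ∀ i j, μ.real (A i ∩ A j) ≤ μ.real (A i) * μ.real (A j) +
      (w i j * μ.real (A j) + w j i * μ.real (A i)))
    (hC : ∀ (Q : Finset ι) (j : ι), ∑ i ∈ Q, w i j ≤ C) :
    ∀ᵐ ω ∂μ, ∃ᶠ i in cofinite, ω ∈ A i := by
  have hoff (F : Finset ι) : ∀ᵐ ω ∂μ, ∃ i : {i // i ∉ F}, ω ∈ A i :=
    ae_exists_mem_of_not_summable (w := fun i j => w i j) (C := C) (fun i => hA i)
      (fun h => hdiv (F.summable_compl_iff.1 h)) (fun i j => hw i j) fun Q j =>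
      (Finset.sum_map Q (.subtype _) fun i => w i j).symm.trans_le (hC _ j)
  filter_upwards [ae_all_iff.2 hoff] with ω hω
  refine frequently_cofinite_iff_infinite.2 fun hfin => ?_
  obtain ⟨i, hi⟩ := hω hfin.toFinset
  exact i.2 (hfin.mem_toFinset.2 hi)

end SecondMoment

section IIDUniform

/-- The law of a family of independent letters, indexed by `ι`, each of them uniformly distributed
in the alphabet `α`. -/
noncomputable abbrev iidUniform (ι α : Type*) [Fintype α] [Nonempty α] [MeasurableSpace α] :
    Measure (ι → α) :=
  Measure.infinitePi fun _ => (PMF.uniformOfFintype α).toMeasure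

variable {ι α : Type*} [MeasurableSpace α] [MeasurableSingletonClass α]

theorem measurableSet_setOf_apply_eq (v : ι) (c : α) : MeasurableSet {ω : ι → α | ω v = c} :=
  (measurableSet_singleton c).preimage (measurable_pi_apply v)

theorem measurableSet_setOf_apply_eq_apply [Countable α] (v w : ι) :
    MeasurableSet {ω : ι → α | ω v = ω w} :=
  measurableSet_eq_fun (measurable_pi_apply v) (measurable_pi_apply w)

theorem sum_measureReal_setOf_apply_eq_inter [Fintype α] {μ : Measure (ι → α)} [IsFiniteMeasure μ]
    {G : Set (ι → α)} (hG : MeasurableSet G) (v : ι) :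
    ∑ c : α, μ.real ({ω | ω v = c} ∩ G) = μ.real G := by
  rw [← measureReal_biUnion_finset _ fun c _ => (measurableSet_setOf_apply_eq v c).inter hG]
  · congr 1
    ext ω
    simp
  · exact fun c _ c' _ hcc' => Set.disjoint_left.2 fun ω hc hc' => hcc' (hc.1.symm.trans hc'.1)

variable [Fintype α] [Nonempty α]

theorem toMeasure_uniformOfFintype_singleton (c : α) :
    (PMF.uniformOfFintype α).toMeasure {c} = (Fintype.card α : ENNReal)⁻¹ := by
  rw [PMF.toMeasure_apply_singleton _ _ (measurableSet_singleton c),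
    PMF.uniformOfFintype_apply]

theorem measurePreserving_perm_uniformOfFintype (σ : Equiv.Perm α) :
    MeasurePreserving σ (PMF.uniformOfFintype α).toMeasure
      (PMF.uniformOfFintype α).toMeasure := by
  refine ⟨measurable_of_finite σ, Measure.ext_of_singleton fun c => ?_⟩
  rw [Measure.map_apply (measurable_of_finite σ) (measurableSet_singleton c),
    ← Equiv.image_symm_eq_preimage, Set.image_singleton, toMeasure_uniformOfFintype_singleton,
    toMeasure_uniformOfFintype_singleton]

theorem measurePreserving_update_perm [DecidableEq ι] (v : ι) (σ : Equiv.Perm α) :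
    MeasurePreserving (fun ω : ι → α => Function.update ω v (σ (ω v)))
      (iidUniform ι α) (iidUniform ι α) := by
  have hcoord (i : ι) : MeasurePreserving
      ((if i = v then σ else Equiv.refl α : Equiv.Perm α) : α → α)
      (PMF.uniformOfFintype α).toMeasure (PMF.uniformOfFintype α).toMeasure :=
    measurePreserving_perm_uniformOfFintype _
  have hupdate : (fun ω : ι → α => Function.update ω v (σ (ω v))) =
      fun ω i => (if i = v then σ else Equiv.refl α : Equiv.Perm α) (ω i) := by
    ext ω i
    by_cases hi : i = v
    · subst hi
      simp
    · simp [hi]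
  rw [hupdate]
  refine ⟨measurable_pi_lambda _ fun i => (hcoord i).measurable.comp (measurable_pi_apply i), ?_⟩
  rw [iidUniform, Measure.infinitePi_map_pi _ fun i => (hcoord i).measurable]
  simp only [(hcoord _).map_eq]

/-- Permuting the letter at `v` shows that all the values of `c` are equally likely. -/
theorem measureReal_setOf_apply_eq_inter {G : Set (ι → α)} {v : ι}
    (hG : MeasurableSet G) (hGv : DependsOn (· ∈ G) {v}ᶜ) (c : α) :
    (iidUniform ι α).real ({ω | ω v = c} ∩ G) =
      (Fintype.card α : ℝ)⁻¹ * (iidUniform ι α).real G := by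
  classical
  have hswap (d : α) : (iidUniform ι α).real ({ω | ω v = d} ∩ G) =
      (iidUniform ι α).real ({ω | ω v = c} ∩ G) := by
    have hpre : (fun ω : ι → α => Function.update ω v (Equiv.swap c d (ω v))) ⁻¹'
        ({ω | ω v = c} ∩ G) = {ω | ω v = d} ∩ G := by
      ext ω
      have hωG : (Function.update ω v (Equiv.swap c d (ω v)) ∈ G) = (ω ∈ G) :=
        hGv fun i hi => Function.update_of_ne hi _ _
      simp [hωG, Equiv.swap_apply_eq_iff]
    rw [← hpre]
    exact (measurePreserving_update_perm v _).measureReal_preimage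
      ((measurableSet_setOf_apply_eq v c).inter hG).nullMeasurableSet
  rw [← sum_measureReal_setOf_apply_eq_inter hG v, Finset.sum_congr rfl fun d _ => hswap d]
  simp

theorem measureReal_setOf_apply_eq_apply_inter {G : Set (ι → α)} {v w : ι} (hvw : v ≠ w)
    (hG : MeasurableSet G) (hGv : DependsOn (· ∈ G) {v}ᶜ) :
    (iidUniform ι α).real ({ω | ω v = ω w} ∩ G) =
      (Fintype.card α : ℝ)⁻¹ * (iidUniform ι α).real G := by
  have hmeas (c : α) : MeasurableSet ({ω | ω w = c} ∩ G) :=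
    (measurableSet_setOf_apply_eq w c).inter hG
  have hdep (c : α) : DependsOn (· ∈ {ω | ω w = c} ∩ G) {v}ᶜ := fun ω ω' h => by
    have hωG : (ω ∈ G) = (ω' ∈ G) := hGv h
    simp only [Set.mem_inter_iff, Set.mem_ofPred_eq, h w hvw.symm, hωG]
  rw [← sum_measureReal_setOf_apply_eq_inter hG w, Finset.mul_sum,
    ← sum_measureReal_setOf_apply_eq_inter ((measurableSet_setOf_apply_eq_apply v w).inter hG) w]
  refine Finset.sum_congr rfl fun c _ => ?_
  rw [← measureReal_setOf_apply_eq_inter (hmeas c) (hdep c) c]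
  congr 1
  ext ω
  simp only [Set.mem_inter_iff, Set.mem_ofPred_eq]
  grind

/-- In the order of increasing `key`, every equation `ω (a k) = ω (b k)` constrains a letter
`ω (a k)` that does not occur in the preceding equations. -/
theorem measureReal_setOf_forall_apply_eq {κ β : Type*} [LinearOrder β] {s : Finset κ}
    {a b : κ → ι} (key : κ → β) (ha : Set.InjOn a s)
    (hab : ∀ k ∈ s, ∀ k' ∈ s, key k' ≤ key k → a k ≠ b k') :
    (iidUniform ι α).real {ω | ∀ k ∈ s, ω (a k) = ω (b k)} =
      (Fintype.card α : ℝ)⁻¹ ^ s.card := by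
  classical
  induction s using Finset.induction_on_max_value key with
  | empty => simp
  | insert x s hx hmax ih =>
    have hsplit : {ω : ι → α | ∀ k ∈ insert x s, ω (a k) = ω (b k)} =
        {ω | ω (a x) = ω (b x)} ∩ {ω | ∀ k ∈ s, ω (a k) = ω (b k)} := by
      ext ω
      simp
    have hmeas : MeasurableSet {ω : ι → α | ∀ k ∈ s, ω (a k) = ω (b k)} := by
      simp only [Set.ofPred_forall]
      exact Finset.measurableSet_biInter _ fun k _ => measurableSet_setOf_apply_eq_apply _ _
    have hdep : DependsOn (· ∈ {ω : ι → α | ∀ k ∈ s, ω (a k) = ω (b k)}) {a x}ᶜ := by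
      intro ω ω' h
      refine propext (forall₂_congr fun k hk => ?_)
      have hak : a k ≠ a x := fun hkx =>
        hx (ha (Finset.mem_insert_of_mem hk) (Finset.mem_insert_self x s) hkx ▸ hk)
      have hbk : b k ≠ a x := (hab x (Finset.mem_insert_self x s) k
        (Finset.mem_insert_of_mem hk) (hmax k hk)).symm
      rw [h (a k) hak, h (b k) hbk]
    have hne : a x ≠ b x :=
      hab x (Finset.mem_insert_self x s) x (Finset.mem_insert_self x s) le_rfl
    rw [hsplit, measureReal_setOf_apply_eq_apply_inter hne hmeas hdep,
      ih (ha.mono (by simp)) fun k hk k' hk' =>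
        hab k (Finset.mem_insert_of_mem hk) k' (Finset.mem_insert_of_mem hk'),
      Finset.card_insert_of_notMem hx, pow_succ']

end IIDUniform

section NullSingleton

variable {ι α : Type*} [MeasurableSpace α] [MeasurableSingletonClass α] [Fintype α]

theorem nullSingletonClass_iidUniform [Nontrivial α] [Infinite ι] :
    NullSingletonClass (iidUniform ι α) := by
  refine ⟨fun ω => le_antisymm (ge_of_tendsto' (ENNReal.tendsto_pow_atTop_nhds_zero_of_lt_one
    (r := (Fintype.card α : ENNReal)⁻¹) ?_) fun n => ?_) zero_le⟩
  · exact ENNReal.inv_lt_one.2 (by exact_mod_cast Fintype.one_lt_card)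
  · obtain ⟨s, hs⟩ := Infinite.exists_subset_card_eq ι n
    calc iidUniform ι α {ω} ≤ iidUniform ι α ((s : Set ι).pi fun i => {ω i}) :=
          measure_mono (by rintro _ rfl i _; rfl)
      _ = (Fintype.card α : ENNReal)⁻¹ ^ n := by
          rw [Measure.infinitePi_pi _ fun i _ => measurableSet_singleton (ω i)]
          simp only [toMeasure_uniformOfFintype_singleton, Finset.prod_const, hs]

end NullSingleton

section BlockMatch

variable {α : Type*}

/-- The words in which the block of length `l` at position `n` repeats the one at position `m`. -/
def blockMatch (n m l : ℕ) : Set (ℕ → α) := {ω | ∀ i < l, ω (n + i) = ω (m + i)}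

theorem blockMatch_inter_subset {n m l n' m' l' : ℕ} (hn : n ≤ n') (hl : n' ≤ n + l)
    (hshift : n + m' = n' + m) :
    (blockMatch n m l ∩ blockMatch n' m' l' : Set (ℕ → α)) ⊆ blockMatch n m (n' - n + l') := by
  intro ω hω i hi
  by_cases hil : i < l
  · exact hω.1 i hil
  · have hi' := hω.2 (i - (n' - n)) (by omega)
    rwa [show n' + (i - (n' - n)) = n + i by omega,
      show m' + (i - (n' - n)) = m + i by omega] at hi'

variable [MeasurableSpace α] [MeasurableSingletonClass α]

theorem measurableSet_blockMatch [Countable α] (n m l : ℕ) :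
    MeasurableSet (blockMatch n m l : Set (ℕ → α)) := by
  simp only [blockMatch, Set.ofPred_forall]
  exact .iInter fun i => .iInter fun _ => measurableSet_setOf_apply_eq_apply _ _

variable [Fintype α] [Nonempty α] {n m l n' m' l' : ℕ}

theorem measureReal_blockMatch (h : m < n) (l : ℕ) :
    (iidUniform ℕ α).real (blockMatch n m l) = (Fintype.card α : ℝ)⁻¹ ^ l := by
  have hmatch : (blockMatch n m l : Set (ℕ → α)) =
      {ω | ∀ i ∈ Finset.range l, ω (n + i) = ω (m + i)} := by
    simp [blockMatch]
  rw [hmatch, measureReal_setOf_forall_apply_eq (a := (n + ·)) (b := (m + ·)) id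
    (add_right_injective n).injOn (by grind), Finset.card_range]

theorem measureReal_blockMatch_inter_of_disjoint (h : m < n) (h' : m' < n') (hn : n + l ≤ n') :
    (iidUniform ℕ α).real (blockMatch n m l ∩ blockMatch n' m' l') =
      (Fintype.card α : ℝ)⁻¹ ^ l * (Fintype.card α : ℝ)⁻¹ ^ l' := by
  have hmatch : (blockMatch n m l ∩ blockMatch n' m' l' : Set (ℕ → α)) =
      {ω | ∀ k ∈ (Finset.range l).disjSum (Finset.range l'),
        ω (Sum.elim (n + ·) (n' + ·) k) = ω (Sum.elim (m + ·) (m' + ·) k)} := by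
    ext ω
    simp [blockMatch]
  rw [hmatch, measureReal_setOf_forall_apply_eq (Sum.elim (n + ·) (n' + ·))]
  · rw [Finset.card_disjSum, Finset.card_range, Finset.card_range, pow_add]
  · rintro (i | i) hi (j | j) hj hij <;>
      simp only [Finset.mem_coe, Finset.inl_mem_disjSum, Finset.inr_mem_disjSum, Finset.mem_range,
        Sum.elim_inl, Sum.elim_inr, Sum.inl.injEq, Sum.inr.injEq, reduceCtorEq] at hi hj hij ⊢ <;>
      omega
  · rintro (i | i) hi (j | j) hj hij <;>
      simp only [Finset.inl_mem_disjSum, Finset.inr_mem_disjSum, Finset.mem_range,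
        Sum.elim_inl, Sum.elim_inr] at hi hj hij ⊢ <;>
      omega

/-- The first match is read as constraining its later block and the second one as constraining its
earlier block; processing the equations by decreasing position in the later block (`n + i` or
`n' + j`, ties going to the first match), each of them constrains a fresh coordinate. -/
theorem measureReal_blockMatch_inter_of_lt (h₁ : m + l ≤ n) (h₂ : m' + l' ≤ n)
    (hlt : n + m' < n' + m) :
    (iidUniform ℕ α).real (blockMatch n m l ∩ blockMatch n' m' l') =
      (Fintype.card α : ℝ)⁻¹ ^ l * (Fintype.card α : ℝ)⁻¹ ^ l' := by
  have hmatch : (blockMatch n m l ∩ blockMatch n' m' l' : Set (ℕ → α)) =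
      {ω | ∀ k ∈ (Finset.range l).disjSum (Finset.range l'),
        ω (Sum.elim (n + ·) (m' + ·) k) = ω (Sum.elim (m + ·) (n' + ·) k)} := by
    ext ω
    simp [blockMatch, eq_comm]
  rw [hmatch, measureReal_setOf_forall_apply_eq
    (Sum.elim (fun i : ℕ => -2 * (n + i : ℤ)) fun j : ℕ => -2 * (n' + j : ℤ) + 1)]
  · rw [Finset.card_disjSum, Finset.card_range, Finset.card_range, pow_add]
  · rintro (i | i) hi (j | j) hj hij <;>
      simp only [Finset.mem_coe, Finset.inl_mem_disjSum, Finset.inr_mem_disjSum, Finset.mem_range,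
        Sum.elim_inl, Sum.elim_inr, Sum.inl.injEq, Sum.inr.injEq, reduceCtorEq] at hi hj hij ⊢ <;>
      omega
  · rintro (i | i) hi (j | j) hj hij <;>
      simp only [Finset.inl_mem_disjSum, Finset.inr_mem_disjSum, Finset.mem_range,
        Sum.elim_inl, Sum.elim_inr] at hi hj hij ⊢ <;>
      omega

theorem measureReal_blockMatch_inter_of_ne
    (h₁ : m + l ≤ n) (h₂ : m + l ≤ n') (h₃ : m' + l' ≤ n) (h₄ : m' + l' ≤ n')
    (hne : n + m' ≠ n' + m) :
    (iidUniform ℕ α).real (blockMatch n m l ∩ blockMatch n' m' l') =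
      (Fintype.card α : ℝ)⁻¹ ^ l * (Fintype.card α : ℝ)⁻¹ ^ l' := by
  rcases hne.lt_or_gt with hlt | hlt
  · exact measureReal_blockMatch_inter_of_lt h₁ h₃ hlt
  · rw [Set.inter_comm, mul_comm]
    exact measureReal_blockMatch_inter_of_lt h₄ h₂ hlt

theorem measureReal_blockMatch_inter_le (h : m < n) (hn : n ≤ n') (hl : n' ≤ n + l)
    (hshift : n + m' = n' + m) :
    (iidUniform ℕ α).real (blockMatch n m l ∩ blockMatch n' m' l') ≤
      (Fintype.card α : ℝ)⁻¹ ^ (n' - n) * (Fintype.card α : ℝ)⁻¹ ^ l' := by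
  rw [← pow_add, ← measureReal_blockMatch h]
  exact measureReal_mono (blockMatch_inter_subset hn hl hshift)

end BlockMatch

section Pairs

/-- The pairs `(n, m)` of positions whose blocks of length `l n` are compared. The constraints make
the blocks so short and so far apart that two pairs whose later blocks overlap have their earlier
blocks before both later blocks. -/
def matchPairs (l : ℕ → ℕ) : Set (ℕ × ℕ) := {p | 2 * p.2 < p.1 ∧ 4 * l p.1 ≤ p.1}

/-- The weight `ρ ^ (n' - n)` of pairs `(n, m)`, `(n', m')` of positions with the same shift
`n - m = n' - m'` and `n ≤ n'`, other pairs having weight zero. It bounds the correlation of matches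
with overlapping blocks. -/
noncomputable def overlapWeight (ρ : ℝ) (p q : ℕ × ℕ) : ℝ :=
  if p.1 + q.2 = q.1 + p.2 ∧ p.1 ≤ q.1 then ρ ^ (q.1 - p.1) else 0

theorem overlapWeight_nonneg {ρ : ℝ} (hρ : 0 ≤ ρ) (p q : ℕ × ℕ) : 0 ≤ overlapWeight ρ p q := by
  unfold overlapWeight
  split_ifs <;> positivity

theorem sum_overlapWeight_le {ρ : ℝ} (hρ0 : 0 ≤ ρ) (hρ1 : ρ < 1) (Q : Finset (ℕ × ℕ)) (q : ℕ × ℕ) :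
    ∑ p ∈ Q, overlapWeight ρ p q ≤ (1 - ρ)⁻¹ := by
  have hinj : Set.InjOn (fun p : ℕ × ℕ => q.1 - p.1)
      (Q.filter fun p => p.1 + q.2 = q.1 + p.2 ∧ p.1 ≤ q.1) := by
    rintro ⟨n, m⟩ h ⟨n', m'⟩ h' heq
    simp only [Finset.coe_filter, Set.mem_ofPred_eq] at h h' heq
    rw [Prod.mk.injEq]
    omega
  simp only [overlapWeight]
  rw [← Finset.sum_filter, ← Finset.sum_image (f := fun k => ρ ^ k) hinj,
    ← tsum_geometric_of_lt_one hρ0 hρ1]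
  exact (summable_geometric_of_lt_one hρ0 hρ1).sum_le_tsum _ fun k _ => pow_nonneg hρ0 k

variable {α : Type*} [Fintype α] [Nonempty α] [MeasurableSpace α] [MeasurableSingletonClass α]
  {l : ℕ → ℕ} {p q : ℕ × ℕ}

theorem measureReal_blockMatch_inter_le_of_fst_le (hp : p ∈ matchPairs l) (hq : q ∈ matchPairs l)
    (hpq : p.1 ≤ q.1) :
    (iidUniform ℕ α).real (blockMatch p.1 p.2 (l p.1) ∩ blockMatch q.1 q.2 (l q.1)) ≤
      (Fintype.card α : ℝ)⁻¹ ^ l p.1 * (Fintype.card α : ℝ)⁻¹ ^ l q.1 +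
        overlapWeight (Fintype.card α : ℝ)⁻¹ p q * (Fintype.card α : ℝ)⁻¹ ^ l q.1 := by
  obtain ⟨hp, hlp⟩ := hp
  obtain ⟨hq, hlq⟩ := hq
  set ρ : ℝ := (Fintype.card α : ℝ)⁻¹
  have hρ : 0 ≤ ρ := by positivity
  have hw : 0 ≤ overlapWeight ρ p q * ρ ^ l q.1 :=
    mul_nonneg (overlapWeight_nonneg hρ p q) (by positivity)
  by_cases hdisj : p.1 + l p.1 ≤ q.1
  · rw [measureReal_blockMatch_inter_of_disjoint (by omega) (by omega) hdisj]
    exact le_add_of_nonneg_right hw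
  by_cases hshift : p.1 + q.2 = q.1 + p.2
  · rw [overlapWeight, if_pos ⟨hshift, hpq⟩]
    exact (measureReal_blockMatch_inter_le (by omega) hpq (by omega) hshift).trans
      (le_add_of_nonneg_left (by positivity))
  · rw [measureReal_blockMatch_inter_of_ne (by omega) (by omega) (by omega) (by omega) hshift]
    exact le_add_of_nonneg_right hw

theorem measureReal_blockMatch_inter_le_of_mem_matchPairs (hp : p ∈ matchPairs l)
    (hq : q ∈ matchPairs l) :
    (iidUniform ℕ α).real (blockMatch p.1 p.2 (l p.1) ∩ blockMatch q.1 q.2 (l q.1)) ≤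
      (Fintype.card α : ℝ)⁻¹ ^ l p.1 * (Fintype.card α : ℝ)⁻¹ ^ l q.1 +
        (overlapWeight (Fintype.card α : ℝ)⁻¹ p q * (Fintype.card α : ℝ)⁻¹ ^ l q.1 +
          overlapWeight (Fintype.card α : ℝ)⁻¹ q p * (Fintype.card α : ℝ)⁻¹ ^ l p.1) := by
  have hρ : 0 ≤ (Fintype.card α : ℝ)⁻¹ := by positivity
  have hpq := mul_nonneg (overlapWeight_nonneg hρ p q) (pow_nonneg hρ (l q.1))
  have hqp := mul_nonneg (overlapWeight_nonneg hρ q p) (pow_nonneg hρ (l p.1))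
  rcases le_total p.1 q.1 with h | h
  · linarith [measureReal_blockMatch_inter_le_of_fst_le (α := α) hp hq h]
  · rw [Set.inter_comm]
    linarith [measureReal_blockMatch_inter_le_of_fst_le (α := α) hq hp h]

theorem summable_mul_pow_of_not_mul_le {ρ : ℝ} (hρ0 : 0 ≤ ρ) (hρ1 : ρ < 1) {k : ℕ} (hk : k ≠ 0)
    (l : ℕ → ℕ) : Summable fun n : {n // ¬ k * l n ≤ n} => (n : ℝ) * ρ ^ l n := by
  set c : ℝ := ρ ^ (k : ℝ)⁻¹
  have hck : c ^ k = ρ := Real.rpow_inv_natCast_pow hρ0 hk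
  have hc0 : 0 ≤ c := Real.rpow_nonneg hρ0 _
  have hc1 : c < 1 := Real.rpow_lt_one hρ0 hρ1 (by positivity)
  have hgeom : Summable fun n : ℕ => (n : ℝ) ^ 1 * c ^ n :=
    summable_pow_mul_geometric_of_norm_lt_one 1 (by rwa [Real.norm_of_nonneg hc0])
  refine .of_nonneg_of_le (fun n => by positivity) (fun n => ?_) (hgeom.subtype _)
  rw [← hck, ← pow_mul]
  simpa using mul_le_mul_of_nonneg_left
    (pow_le_pow_of_le_one hc0 hc1.le (not_le.1 n.2).le) n.1.cast_nonneg

theorem tsum_indicator_matchPairs (ρ : ℝ) {n : ℕ} (hn : 4 * l n ≤ n) :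
    ∑' m, (matchPairs l).indicator (fun p => ρ ^ l p.1) (n, m) =
      ((n + 1) / 2 : ℕ) * ρ ^ l n := by
  have hmem (m : ℕ) : (n, m) ∈ matchPairs l ↔ m ∈ Finset.range ((n + 1) / 2) := by
    simp only [matchPairs, Set.mem_ofPred_eq, Finset.mem_range]
    omega
  rw [tsum_eq_sum (s := Finset.range ((n + 1) / 2)) fun m hm =>
      Set.indicator_of_notMem (mt (hmem m).1 hm) _,
    Finset.sum_congr rfl fun m hm => Set.indicator_of_mem ((hmem m).2 hm) _]
  simp

theorem not_summable_pow_matchPairs {ρ : ℝ} (hρ0 : 0 ≤ ρ) (hρ1 : ρ < 1)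
    (hdiv : ¬ Summable fun n : ℕ => (n : ℝ) * ρ ^ l n) :
    ¬ Summable fun p : matchPairs l => ρ ^ l (p : ℕ × ℕ).1 := by
  intro hsum
  have hind : Summable ((matchPairs l).indicator fun p => ρ ^ l p.1) :=
    summable_subtype_iff_indicator.1 hsum
  have hfst : Summable fun n => ∑' m, (matchPairs l).indicator (fun p => ρ ^ l p.1) (n, m) :=
    ((summable_prod_of_nonneg (Set.indicator_nonneg fun p _ => pow_nonneg hρ0 _)).1 hind).2
  have hshort : Summable fun n : {n // 4 * l n ≤ n} => (n : ℝ) * ρ ^ l n := by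
    refine .of_nonneg_of_le (fun n => by positivity) (fun n => ?_) ((hfst.mul_left 2).subtype _)
    have hcount : (n : ℝ) ≤ 2 * ((n + 1) / 2 : ℕ) := by exact_mod_cast (by omega)
    simp only [Function.comp_apply]
    rw [tsum_indicator_matchPairs ρ n.2, ← mul_assoc]
    exact mul_le_mul_of_nonneg_right hcount (by positivity)
  exact hdiv (summable_subtype_and_compl.1
    ⟨hshort, summable_mul_pow_of_not_mul_le hρ0 hρ1 four_ne_zero l⟩)

end Pairs

theorem ae_frequently_exists_mem_blockMatch {α : Type*} [Fintype α] [Nontrivial α]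
    [MeasurableSpace α] [MeasurableSingletonClass α] {l : ℕ → ℕ}
    (hdiv : ¬ Summable fun n : ℕ => (n : ℝ) * (Fintype.card α : ℝ)⁻¹ ^ l n) :
    ∀ᵐ ω ∂iidUniform ℕ α, ∃ᶠ n in atTop, ∃ m < n, m + l n ≤ n ∧ ω ∈ blockMatch n m (l n) := by
  set ρ : ℝ := (Fintype.card α : ℝ)⁻¹
  have hρ0 : 0 ≤ ρ := by positivity
  have hρ1 : ρ < 1 := inv_lt_one_of_one_lt₀ (by exact_mod_cast Fintype.one_lt_card)
  have hprob (p : matchPairs l) : (iidUniform ℕ α).real (blockMatch p.1.1 p.1.2 (l p.1.1)) =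
      ρ ^ l p.1.1 := measureReal_blockMatch (by have := p.2.1; omega) _
  have hpairs : ∀ᵐ ω ∂iidUniform ℕ α, ∃ᶠ p : matchPairs l in cofinite,
      ω ∈ blockMatch p.1.1 p.1.2 (l p.1.1) := by
    refine ae_frequently_mem_of_not_summable (w := fun p q => overlapWeight ρ p q)
      (C := (1 - ρ)⁻¹) (fun p => measurableSet_blockMatch _ _ _) ?_ (fun p q => ?_) fun Q q => ?_
    · simpa only [hprob] using not_summable_pow_matchPairs hρ0 hρ1 hdiv
    · simpa only [hprob] using measureReal_blockMatch_inter_le_of_mem_matchPairs p.2 q.2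
    · exact (Finset.sum_map Q (.subtype _) fun p => overlapWeight ρ p q).symm.trans_le
        (sum_overlapWeight_le hρ0 hρ1 _ _)
  have hfst : Tendsto (fun p : matchPairs l => p.1.1) cofinite atTop := by
    rw [← Nat.cofinite_eq_atTop]
    refine .cofinite_of_finite_preimage_singleton fun n => ?_
    refine (((Set.finite_singleton n).prod (Set.finite_lt_nat n)).preimage
      Subtype.val_injective.injOn).subset fun p hp => ⟨hp, ?_⟩
    obtain ⟨hp2, -⟩ := p.2
    simp only [Set.mem_preimage, Set.mem_singleton_iff] at hp
    simp only [Set.mem_ofPred_eq]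
    omega
  filter_upwards [hpairs] with ω hω
  refine hfst.frequently (hω.mono fun p hp => ?_)
  obtain ⟨hp2, hlp⟩ := p.2
  exact ⟨p.1.2, by omega, by omega, hp⟩

section Digits

theorem exists_pow_mul_ofDigits_eq_add {b : ℕ} (a : ℕ → Fin b) (n : ℕ) :
    ∃ z : ℤ, (b : ℝ) ^ n * Real.ofDigits a = z + Real.ofDigits fun i => a (i + n) := by
  have hb : (b : ℝ) ≠ 0 := Nat.cast_ne_zero.2 (a 0).pos.ne'
  refine ⟨∑ i ∈ Finset.range n, (a i : ℤ) * b ^ (n - (i + 1)), ?_⟩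
  rw [Real.ofDigits_eq_sum_add_ofDigits a n, mul_add, mul_inv_cancel_left₀ (pow_ne_zero n hb),
    Finset.mul_sum]
  push_cast
  congr 1
  refine Finset.sum_congr rfl fun i hi => ?_
  have hin : i + 1 ≤ n := Finset.mem_range.1 hi
  rw [Real.ofDigitsTerm, pow_sub₀ _ hb hin]
  ring

/-- Multiplying by `b ^ n - b ^ m` turns a number whose digits are periodic from the `m`-th one on,
with period `n - m`, into an integer. -/
theorem exists_rat_eq_ofDigits_of_eventually_periodic {b : ℕ} (hb : 1 < b) {a : ℕ → Fin b}
    {m n : ℕ} (hmn : m < n) (ha : ∀ i, a (i + n) = a (i + m)) :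
    ∃ r : ℚ, r.den ≤ b ^ n ∧ (r : ℝ) = Real.ofDigits a := by
  obtain ⟨z, hz⟩ := exists_pow_mul_ofDigits_eq_add a m
  obtain ⟨w, hw⟩ := exists_pow_mul_ofDigits_eq_add a n
  have hlt : b ^ m < b ^ n := Nat.pow_lt_pow_right hb hmn
  have hN : ((b ^ n - b ^ m : ℕ) : ℝ) = (b : ℝ) ^ n - (b : ℝ) ^ m := by
    rw [Nat.cast_sub hlt.le, Nat.cast_pow, Nat.cast_pow]
  have hN0 : (b : ℝ) ^ n - (b : ℝ) ^ m ≠ 0 := hN ▸ Nat.cast_ne_zero.2 (Nat.sub_pos_of_lt hlt).ne'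
  have hden : ((w - z : ℤ) / ((b ^ n - b ^ m : ℕ) : ℤ) : ℚ).den ∣ b ^ n - b ^ m := by
    exact_mod_cast Rat.den_dvd (w - z) (b ^ n - b ^ m : ℕ)
  refine ⟨(w - z : ℤ) / ((b ^ n - b ^ m : ℕ) : ℤ),
    (Nat.le_of_dvd (Nat.sub_pos_of_lt hlt) hden).trans (Nat.sub_le _ _), ?_⟩
  simp only [ha] at hw
  push_cast [hN]
  rw [div_eq_iff hN0]
  linarith

variable {α : Type*} {m n l : ℕ} {ω : ℕ → α}

/-- The word that starts like `ω` and repeats the letters of `ω` at the positions `m, …, n - 1`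
periodically from position `m` on. -/
def periodize (m n : ℕ) (ω : ℕ → α) : ℕ → α :=
  fun i => if i < m then ω i else ω (m + (i - m) % (n - m))

theorem periodize_add (hmn : m < n) (ω : ℕ → α) (i : ℕ) :
    periodize m n ω (i + n) = periodize m n ω (i + m) := by
  have hshift : i + n - m = i + (n - m) := by omega
  simp [periodize, hshift, show ¬ i + n < m by omega]

theorem periodize_eq_of_mem_blockMatch (h : m + l ≤ n) (hω : ω ∈ blockMatch n m l) {i : ℕ}
    (hi : i < n + l) : periodize m n ω i = ω i := by
  unfold periodize
  split_ifs with him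
  · rfl
  by_cases hin : i < n
  · rw [Nat.mod_eq_of_lt (by omega), Nat.add_sub_cancel' (by omega)]
  · have hmatch : ω (n + (i - n)) = ω (m + (i - n)) := hω (i - n) (by omega)
    rw [Nat.add_sub_cancel' (by omega)] at hmatch
    rw [hmatch, show i - m = i - n + (n - m) by omega, Nat.add_mod_right,
      Nat.mod_eq_of_lt (by omega)]

end Digits

section CantorPoint

theorem cantorPoint_mem_cantorSet (ω : ℕ → Bool) : cantorPoint ω ∈ cantorSet :=
  ofDigits_bool_to_fin_three_mem_cantorSet ω

theorem cantorPoint_injective : Function.Injective cantorPoint := by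
  have hdigit : Function.Injective fun c : Bool => (bif c then 2 else 0 : Fin 3) := by decide
  intro ω ω' h
  have hdigits := ofDigits_zero_two_sequence_unique (by grind) (by grind) h
  exact funext fun n => hdigit (congrFun hdigits n)

theorem abs_cantorPoint_sub_le {ω ω' : ℕ → Bool} {n : ℕ} (h : ∀ i < n, ω i = ω' i) :
    |cantorPoint ω - cantorPoint ω'| ≤ ((3 : ℝ) ^ n)⁻¹ := by
  have hdigits : ∀ i < n, (bif ω i then 2 else 0 : Fin 3) = bif ω' i then 2 else 0 :=
    fun i hi => by rw [h i hi]
  exact_mod_cast Real.abs_ofDigits_sub_ofDigits_le hdigits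

theorem exists_rat_mem_cantorSet_of_mem_blockMatch {m n l : ℕ} {ω : ℕ → Bool} (hmn : m < n)
    (hl : m + l ≤ n) (hω : ω ∈ blockMatch n m l) :
    ∃ r : ℚ, (r : ℝ) ∈ cantorSet ∧ r.den ≤ 3 ^ n ∧
      |cantorPoint ω - r| ≤ ((3 : ℝ) ^ (n + l))⁻¹ := by
  obtain ⟨r, hden, hr⟩ : ∃ r : ℚ, r.den ≤ 3 ^ n ∧ (r : ℝ) = cantorPoint (periodize m n ω) :=
    exists_rat_eq_ofDigits_of_eventually_periodic (by norm_num) hmn fun i => by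
      rw [periodize_add hmn]
  refine ⟨r, hr ▸ cantorPoint_mem_cantorSet _, hden, hr ▸ abs_cantorPoint_sub_le fun i hi => ?_⟩
  exact (periodize_eq_of_mem_blockMatch hl hω hi).symm

theorem ae_irrational_cantorPoint {μ : Measure (ℕ → Bool)} [NullSingletonClass μ] :
    ∀ᵐ ω ∂μ, Irrational (cantorPoint ω) :=
  ((Set.countable_range ((↑) : ℚ → ℝ)).preimage_of_injOn cantorPoint_injective.injOn).ae_notMem μ

end CantorPoint

theorem infinite_of_frequently_abs_sub_le {x : ℝ} (hx : Irrational x) {s : Set ℚ} {u : ℕ → ℝ}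
    (hu : Tendsto u atTop (𝓝 0)) (h : ∃ᶠ n in atTop, ∃ r ∈ s, |x - r| ≤ u n) : s.Infinite := by
  intro hs
  have hmem : x ∈ closure ((↑) '' s : Set ℝ) := by
    refine Metric.mem_closure_iff.2 fun ε hε => ?_
    obtain ⟨n, ⟨r, hr, hrn⟩, hn⟩ := (h.and_eventually (hu.eventually_lt_const hε)).exists
    exact ⟨r, ⟨r, hr, rfl⟩, hrn.trans_lt hn⟩
  rw [(hs.image _).isClosed.closure_eq] at hmem
  obtain ⟨r, -, hr⟩ := hmem
  exact hx ⟨r, hr⟩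

section BlockLength

theorem summable_of_summable_min_of_eventually_one_le {f g : ℕ → ℝ}
    (h : Summable fun n => min (g n) (f n)) (hg : ∀ᶠ n in atTop, 1 ≤ g n) : Summable f := by
  have hlt : ∀ᶠ n in atTop, min (g n) (f n) < 1 :=
    h.tendsto_atTop_zero.eventually_lt_const one_pos
  refine (summable_congr_atTop ?_).1 h
  filter_upwards [hg, hlt] with n hgn hmin
  exact min_eq_right (le_of_not_ge fun hfg => absurd (min_eq_left hfg ▸ hmin) hgn.not_gt)

theorem exists_inv_pow_lt_and_min_rpow_le {b : ℝ} (hb : 1 < b) {q : ℝ} (hq : 1 ≤ q) {z : ℝ}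
    (hz : 0 < z) :
    ∃ l : ℕ, (b ^ l)⁻¹ < z ∧ min 1 (z ^ Real.logb b q) ≤ q * q⁻¹ ^ l := by
  have hb0 : 0 < b := one_pos.trans hb
  have hq0 : 0 < q := one_pos.trans_le hq
  have hlog : 0 ≤ Real.logb b q := Real.logb_nonneg hb hq
  have hmin0 : 0 < min 1 z := lt_min one_pos hz
  obtain ⟨k, hlow, hupp⟩ := exists_nat_pow_near_of_lt_one hmin0 (min_le_left 1 z)
    (inv_pos.2 hb0) (inv_lt_one_of_one_lt₀ hb)
  refine ⟨k + 1, inv_pow b _ ▸ hlow.trans_le (min_le_right 1 z), ?_⟩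
  calc min 1 (z ^ Real.logb b q) = min 1 z ^ Real.logb b q := by
        rw [(Real.monotoneOn_rpow_Ici_of_exponent_nonneg hlog).map_min (Set.mem_Ici.2 zero_le_one)
          (Set.mem_Ici.2 hz.le), Real.one_rpow]
    _ ≤ (b⁻¹ ^ k) ^ Real.logb b q := Real.rpow_le_rpow hmin0.le hupp hlog
    _ = q⁻¹ ^ k := by
        rw [← Real.rpow_natCast, ← Real.rpow_mul (inv_nonneg.2 hb0.le), mul_comm,
          Real.rpow_mul (inv_nonneg.2 hb0.le), Real.inv_rpow hb0.le,
          Real.rpow_logb hb0 hb.ne' hq0, Real.rpow_natCast]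
    _ = q * q⁻¹ ^ (k + 1) := by
        rw [pow_succ']
        field_simp

theorem exists_inv_pow_lt_and_not_summable {b : ℝ} (hb : 1 < b) {q : ℝ} (hq : 1 ≤ q) {y : ℕ → ℝ}
    (hy : ∀ n, 0 < y n)
    (hdiv : ¬ Summable fun n : ℕ => (n : ℝ) * (b ^ n * y n) ^ Real.logb b q) :
    ∃ l : ℕ → ℕ, (∀ n, (b ^ (n + l n))⁻¹ < y n) ∧ ¬ Summable fun n : ℕ => (n : ℝ) * q⁻¹ ^ l n := by
  have hpow (n : ℕ) : 0 < b ^ n := pow_pos (one_pos.trans hb) n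
  choose l hlt hle using fun n => exists_inv_pow_lt_and_min_rpow_le hb hq (mul_pos (hpow n) (hy n))
  refine ⟨l, fun n => ?_, fun hsum => hdiv ?_⟩
  · rw [pow_add, mul_inv, inv_mul_lt_iff₀ (hpow n)]
    exact hlt n
  refine summable_of_summable_min_of_eventually_one_le (g := fun n => (n : ℝ)) ?_
    (tendsto_natCast_atTop_atTop.eventually_ge_atTop 1)
  refine .of_nonneg_of_le (fun n => ?_) (fun n => ?_) (hsum.mul_left q)
  · have := mul_pos (hpow n) (hy n)
    positivity
  · calc min (n : ℝ) (n * (b ^ n * y n) ^ Real.logb b q)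
        = n * min 1 ((b ^ n * y n) ^ Real.logb b q) := by
          rw [mul_min_of_nonneg _ _ n.cast_nonneg, mul_one]
      _ ≤ n * (q * q⁻¹ ^ l n) := mul_le_mul_of_nonneg_left (hle n) n.cast_nonneg
      _ = q * (n * q⁻¹ ^ l n) := mul_left_comm _ _ _

end BlockLength

theorem map_apply_eq_one_of_ae_mem {Ω X : Type*} [MeasurableSpace Ω] [MeasurableSpace X]
    {μ : Measure Ω} [IsProbabilityMeasure μ] {f : Ω → X} {s : Set X} (hf : AEMeasurable f μ)
    (hs : ∀ᵐ ω ∂μ, f ω ∈ s) : μ.map f s = 1 := by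
  have : IsProbabilityMeasure (μ.map f) := Measure.isProbabilityMeasure_map hf
  refine le_antisymm prob_le_one ?_
  calc 1 = μ (f ⁻¹' s) := measure_univ.symm.trans (measure_congr (eventuallyEq_univ.2 hs).symm)
    _ ≤ μ.map f s := Measure.le_map_apply hf s

theorem mainTheorem2 (ψ : ℝ → ℝ)
    (hpos : ∀ t : ℝ, 0 < t → 0 < ψ t)
    (hanti : AntitoneOn ψ (Set.Ioi 0))
    (hdiv : ¬ Summable fun n : ℕ =>
      (n : ℝ) * ((3 : ℝ) ^ n * ψ ((3 : ℝ) ^ n)) ^ (Real.logb 3 2)) :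
    cantorMeasure (intrinsicallyApproximable cantorSet ψ) = 1 := by
  obtain ⟨l, hlt, hsum⟩ := exists_inv_pow_lt_and_not_summable (by norm_num) one_le_two
    (fun n : ℕ => hpos (3 ^ n) (by positivity)) hdiv
  have hrepeat := ae_frequently_exists_mem_blockMatch (α := Bool) (l := l) (by simpa using hsum)
  have : NullSingletonClass (iidUniform ℕ Bool) := nullSingletonClass_iidUniform
  refine map_apply_eq_one_of_ae_mem measurable_cantorPoint.aemeasurable ?_
  filter_upwards [hrepeat, ae_irrational_cantorPoint] with ω hω hirr
  have hu : Tendsto (fun n : ℕ => ((3 : ℝ) ^ n)⁻¹) atTop (𝓝 0) :=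
    (tendsto_pow_atTop_atTop_of_one_lt (by norm_num)).inv_tendsto_atTop
  refine ⟨cantorPoint_mem_cantorSet ω, infinite_of_frequently_abs_sub_le hirr hu (hω.mono ?_)⟩
  rintro n ⟨m, hmn, hml, hmatch⟩
  obtain ⟨r, hr, hden, hclose⟩ := exists_rat_mem_cantorSet_of_mem_blockMatch hmn hml hmatch
  have hψ : ψ (3 ^ n) ≤ ψ r.den :=
    hanti (Set.mem_Ioi.2 (Nat.cast_pos.2 r.den_pos)) (by simp) (by exact_mod_cast hden)
  refine ⟨r, ⟨hr, (hclose.trans_lt (hlt n)).trans_le hψ⟩, hclose.trans ?_⟩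
  gcongr
  · norm_num
  · exact Nat.le_add_right n (l n)
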